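/- Let $X$ be a compact zero-dimensional (Hausdorff) space. A nest of partial homeomorphisms of $X$ is a family $\mathcal N=\{\varphi_n\}_{n\in\mathbb Z}$ of homeomorphisms $\varphi_n$ between open subsets $\mathrm{dom}\,\varphi_n$ and $\mathrm{ran}\,\varphi_n$ of $X$ with $\varphi_0=\mathrm{id}_X$, $\varphi_{-n}=\varphi_n^{-1}$ and $\Gamma(\varphi_n\circ\varphi_m)\subseteq\Gamma(\varphi_{n+m})$ for all $n,m\in\mathbb Z$, where $\Gamma$ denotes the graph. Put $X_{\max}=X\setminus\bigcup_{n\ge1}\mathrm{dom}\,\varphi_n$ and $X_{\min}=X\setminus\bigcup_{n\ge1}\mathrm{dom}\,\varphi_{-n}$. The groupoid defined by $\mathcal N$ is the equivalence relation $\mathcal R=\bigcup_{n\in\mathbb Z}\Gamma(\varphi_n)$ on $X$, with the topology generated by the graphs of the restrictions $\varphi_n|_{U\cap\mathrm{dom}\,\varphi_n}$, $U\subseteq X$ open, $n\in\mathbb Z$. A topologized equivalence relation on $X$ is called an AF groupoid if it is the union of an increasing sequence of open subgroupoids with unit space $X$, each of which is elementary, i.e. isomorphic as a topological groupoid with unit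 space $X$ to a finite disjoint union $\bigsqcup_k Y_k\times\{1,\dots,m_k\}^2$ of products of a space $Y_k$ with the full equivalence relation on $m_k$ points. A Bratteli system is a quadruple $(X,X_{\max},X_{\min},\varphi)$ where $X_{\max},X_{\min}$ are closed subsets of $X$ and $\varphi:X\setminus X_{\max}\to X\setminus X_{\min}$ is a homeomorphism such that $\bigcup_{n\ge0}\varphi^n(U)=X$ for every clopen $U\supseteq X_{\min}$ and $\bigcup_{n\ge0}\varphi^{-n}(V)=X$ for every clopen $V\supseteq X_{\max}$. Here $\varphi^{\pm n}$ is the $n$-fold composite of the partial map $\varphi^{\pm1}$ and $\varphi^{\pm n}(U)$ means $\varphi^{\pm n}(U\cap\mathrm{dom}\,\varphi^{\pm n})$. Lemma. Let $\mathcal N=\{\varphi_n\}_{n\in\mathbb Z}$ be a nest of partial homeomorphisms of $X$ such that 1. $X_{\min}$ and $X_{\max}$ are clopen; 2. for each $n\ge1$, $\mathrm{dom}\,\varphi_n$ and $\mathrm{dom}\,\varphi_{-n}$ are clopen; 3. there exists $M\ge1$ such that $\mathrm{dom}\,\varphi_n=\emptyset$ for $|n|\ge M$. Then the groupoid $\mathcal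 R$ defined by $\mathcal N$ is an AF groupoid. Moreover, the successor map $\Phi$ with domain $X\setminus X_{\max}$, $\Phi(x)=\varphi_k(x)$ for $k=\min\{n\ge1: x\in\mathrm{dom}\,\varphi_n\}$, is a homeomorphism from $X\setminus X_{\max}$ onto $X\setminus X_{\min}$, and $(X,X_{\max},X_{\min},\Phi)$ is a Bratteli system. -/

import Mathlib

open Set

/-- A nest of partial homeomorphisms of `X`: a family `(φ_n)_{n ∈ ℤ}` of homeomorphisms between open
subsets of `X` with `φ_0 = id`, `φ_{-n} = φ_n⁻¹` and `Γ(φ_n ∘ φ_m) ⊆ Γ(φ_{n+m})`.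
The relation `≈` is equality of partial maps (same domain, same values on the domain), so that the
values which Lean assigns outside the domains play no role. -/
structure PartialHomeoNest (X : Type*) [TopologicalSpace X] where
  map : ℤ → OpenPartialHomeomorph X X
  map_zero : map 0 ≈ OpenPartialHomeomorph.refl X
  map_neg : ∀ n : ℤ, map (-n) ≈ (map n).symm
  nested : ∀ (n m : ℤ) (x : X), x ∈ (map m).source → map m x ∈ (map n).source →
    x ∈ (map (n + m)).source ∧ map (n + m) x = map n (map m x)

/-- The arrows of the groupoid given by an equivalence relation `r` on its unit space `X`, that is
the pairs `(x, y)` with `r x y`. This is a type of its own, so that it does not silently carry the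
topology induced by `X × X`, which is in general not the topology of the groupoid. -/
@[ext]
structure RelArrow {X : Type*} (r : Setoid X) where
  src : X
  tgt : X
  rel : r src tgt

namespace PartialHomeoNest

variable {X : Type*} [TopologicalSpace X]

/-- `X_max`: the points which lie in no `dom φ_n`, `n ≥ 1`. -/
def xMax (N : PartialHomeoNest X) : Set X := ⋂ (n : ℤ) (_ : 1 ≤ n), (N.map n).sourceᶜ

/-- `X_min`: the points which lie in no `dom φ_{-n}`, `n ≥ 1`. -/
def xMin (N : PartialHomeoNest X) : Set X := ⋂ (n : ℤ) (_ : 1 ≤ n), (N.map (-n)).sourceᶜ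

/-- The equivalence relation `R = ⋃_n Γ(φ_n)`. -/
def rel (N : PartialHomeoNest X) : Setoid X where
  r x y := ∃ n : ℤ, x ∈ (N.map n).source ∧ N.map n x = y
  iseqv := by
    refine ⟨fun x => ⟨0, ?_, ?_⟩, ?_, ?_⟩
    · rw [N.map_zero.1]; trivial
    · exact N.map_zero.2 (by rw [N.map_zero.1]; trivial)
    · rintro x y ⟨n, hx, rfl⟩
      have hs : N.map n x ∈ (N.map (-n)).source := by
        rw [(N.map_neg n).1]; exact (N.map n).map_source hx
      exact ⟨-n, hs, by rw [(N.map_neg n).2 hs]; exact (N.map n).left_inv hx⟩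
    · rintro x y z ⟨m, hx, rfl⟩ ⟨n, hy, rfl⟩
      exact ⟨n + m, N.nested n m x hx hy⟩

/-- The groupoid `R = ⋃_n Γ(φ_n)` defined by the nest. -/
abbrev Groupoid (N : PartialHomeoNest X) : Type _ := RelArrow N.rel

/-- The graph of the restriction of `φ_n` to `U ∩ dom φ_n`, as a subset of the groupoid. -/
def graphOn (N : PartialHomeoNest X) (n : ℤ) (U : Set X) : Set N.Groupoid :=
  {g | g.src ∈ U ∧ g.src ∈ (N.map n).source ∧ N.map n g.src = g.tgt}

/-- The topology of the groupoid defined by the nest: it is generated by the graphs of the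
restrictions of the `φ_n` to open sets. (When the graphs `Γ(φ_n)` are pairwise disjoint, this is the
disjoint union topology of the graphs, each identified with `dom φ_n`.) -/
instance (N : PartialHomeoNest X) : TopologicalSpace N.Groupoid :=
  TopologicalSpace.generateFrom {W | ∃ (n : ℤ) (U : Set X), IsOpen U ∧ W = N.graphOn n U}

/-- `Φ` is the successor map of the nest: its domain is `X ∖ X_max`, and
`Φ(x) = φ_k(x)` for `k = min {n ≥ 1 : x ∈ dom φ_n}`. -/
def IsSuccessorMap (N : PartialHomeoNest X) (Φ : OpenPartialHomeomorph X X) : Prop :=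
  Φ.source = N.xMaxᶜ ∧
    ∀ x ∈ N.xMaxᶜ, ∀ k : ℤ, IsLeast {n : ℤ | 1 ≤ n ∧ x ∈ (N.map n).source} k → Φ x = N.map k x

end PartialHomeoNest

/-- A set `S` of arrows of the topologized equivalence relation `r` on the compact space `X` is an
elementary groupoid with unit space `X`: as a topological groupoid it is isomorphic to a finite
disjoint union `⨆_k Y_k × {1, …, m_k}²` of products of a space `Y_k` and the full equivalence
relation on `m_k` points (with `((y, i), (y, j))` as arrows). Here `e` is the isomorphism on the
unit spaces and `E` the one on the arrows. As `e` embeds the `Y_k` with `m_k ≥ 1` in `X` as clopen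
subsets, it is no restriction to take clopen subsets `Y_k` of `X`. -/
def IsElementaryGroupoid {X : Type*} [TopologicalSpace X] (r : Setoid X)
    [TopologicalSpace (RelArrow r)] (S : Set (RelArrow r)) : Prop :=
  ∃ (c : ℕ) (m : Fin c → ℕ) (Y : Fin c → Set X), (∀ k, IsClopen (Y k)) ∧
    ∃ (e : (Σ k : Fin c, Y k × Fin (m k)) ≃ₜ X)
      (E : (Σ k : Fin c, Y k × (Fin (m k) × Fin (m k))) ≃ₜ S),
      ∀ (k : Fin c) (y : Y k) (i j : Fin (m k)),
        (E ⟨k, (y, (i, j))⟩ : RelArrow r).src = e ⟨k, (y, i)⟩ ∧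
        (E ⟨k, (y, (i, j))⟩ : RelArrow r).tgt = e ⟨k, (y, j)⟩

/-- An equivalence relation `r` on the compact space `X`, with a topology on its arrows, is an AF
groupoid: it is the union of an increasing sequence of open elementary subgroupoids with the same
unit space `X`. (This forces `r` to be an étale topological groupoid with unit space `X`.) -/
def IsAFGroupoid {X : Type*} [TopologicalSpace X] (r : Setoid X)
    [TopologicalSpace (RelArrow r)] : Prop :=
  ∃ S : ℕ → Set (RelArrow r), Monotone S ∧ (⋃ n, S n) = univ ∧
    ∀ n, IsOpen (S n) ∧ IsElementaryGroupoid r (S n)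

/-- The `n`-fold composite of a partial homeomorphism, with its maximal domain. -/
def OpenPartialHomeomorph.iter {X : Type*} [TopologicalSpace X] (φ : OpenPartialHomeomorph X X) :
    ℕ → OpenPartialHomeomorph X X
  | 0 => OpenPartialHomeomorph.refl X
  | n + 1 => (φ.iter n).trans φ

/-- `(X, X_max, X_min, φ)` is a Bratteli system (on the compact zero-dimensional space `X`). -/
structure IsBratteliSystem {X : Type*} [TopologicalSpace X] (xMax xMin : Set X)
    (φ : OpenPartialHomeomorph X X) : Prop where
  isClosed_max : IsClosed xMax
  isClosed_min : IsClosed xMin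
  source_eq : φ.source = xMaxᶜ
  target_eq : φ.target = xMinᶜ
  forward : ∀ U : Set X, IsClopen U → xMin ⊆ U →
    (⋃ n : ℕ, φ.iter n '' (U ∩ (φ.iter n).source)) = univ
  backward : ∀ V : Set X, IsClopen V → xMax ⊆ V →
    (⋃ n : ℕ, φ.symm.iter n '' (V ∩ (φ.symm.iter n).source)) = univ

/-! Since only finitely many `φ_n` are nonempty, every orbit is finite. It contains exactly one
point `y` of `X_min` (`Bounded.exists_base`, `base_unique`) and equals `{φ_a y : a ∈ A}`, where `A ⊆
{0, …, M-1}` is the set of times at which `y` lies in a domain. Clopen domains make `A` locally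
constant on `X_min`, so `X_min` splits into finitely many clopen pieces `baseSet A`, and the
groupoid is the disjoint union of the `baseSet A × A²`. It is thus elementary itself, and a constant
sequence exhibits it as AF.

The successor map agrees locally with a single `φ_k`, and its inverse is the successor map of the
reversed nest `rev`. Passing to the successor shortens the bounded set of future times, so `X_max`
is reached after finitely many steps; the statement about `X_min` follows by reversal. -/

namespace PartialHomeoNest

variable {X : Type*} [TopologicalSpace X]

/-- The nest `(φ_{-n})_n`, which exchanges the roles of `X_max` and `X_min`. -/
def rev (N : PartialHomeoNest X) : PartialHomeoNest X where
  map n := N.map (-n)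
  map_zero := by simpa using N.map_zero
  map_neg n := N.map_neg (-n)
  nested n m x hx hy := by
    rw [neg_add]
    exact N.nested (-n) (-m) x hx hy

theorem rev_map (N : PartialHomeoNest X) (n : ℤ) : N.rev.map n = N.map (-n) := rfl

theorem xMin_rev (N : PartialHomeoNest X) : N.rev.xMin = N.xMax := by
  simp [xMin, xMax, rev_map]

theorem rev_rev (N : PartialHomeoNest X) : N.rev.rev = N := by
  cases N
  simp [rev]

theorem mem_zero (N : PartialHomeoNest X) (x : X) : x ∈ (N.map 0).source := by
  rw [N.map_zero.1]; trivial

theorem map_zero_apply (N : PartialHomeoNest X) (x : X) : N.map 0 x = x :=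
  N.map_zero.2 (N.mem_zero x)

theorem mem_neg (N : PartialHomeoNest X) {n : ℤ} {x : X} (hx : x ∈ (N.map n).source) :
    N.map n x ∈ (N.map (-n)).source := by
  rw [(N.map_neg n).1]; exact (N.map n).map_source hx

theorem map_neg_apply (N : PartialHomeoNest X) {n : ℤ} {x : X} (hx : x ∈ (N.map n).source) :
    N.map (-n) (N.map n x) = x := by
  rw [(N.map_neg n).2 (N.mem_neg hx)]; exact (N.map n).left_inv hx

/-- If `φ_a` and `φ_b` are defined at `x`, then `φ_{b-a}` takes `φ_a x` to `φ_b x`. -/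
theorem map_sub (N : PartialHomeoNest X) {a b : ℤ} {x : X} (ha : x ∈ (N.map a).source)
    (hb : x ∈ (N.map b).source) :
    N.map a x ∈ (N.map (b - a)).source ∧ N.map (b - a) (N.map a x) = N.map b x := by
  have h := N.nested b (-a) (N.map a x) (N.mem_neg ha) (by rwa [N.map_neg_apply ha])
  rwa [N.map_neg_apply ha, ← sub_eq_add_neg] at h

theorem mem_xMax (N : PartialHomeoNest X) {x : X} :
    x ∈ N.xMax ↔ ∀ n : ℤ, 1 ≤ n → x ∉ (N.map n).source := by
  simp [xMax]

theorem mem_xMin (N : PartialHomeoNest X) {x : X} :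
    x ∈ N.xMin ↔ ∀ n : ℤ, 1 ≤ n → x ∉ (N.map (-n)).source := by
  simp [xMin]

theorem nonneg_of_mem_xMin (N : PartialHomeoNest X) {x : X} (hx : x ∈ N.xMin) {n : ℤ}
    (hn : x ∈ (N.map n).source) : 0 ≤ n := by
  by_contra! h
  exact N.mem_xMin.1 hx (-n) (by omega) (by rwa [neg_neg])

/-- All but finitely many of the `φ_n` are empty. -/
def Bounded (N : PartialHomeoNest X) (M : ℕ) : Prop :=
  ∀ n : ℤ, ∀ x ∈ (N.map n).source, |n| < M

theorem Bounded.rev {N : PartialHomeoNest X} {M : ℕ} (h : N.Bounded M) : N.rev.Bounded M := by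
  intro n x hx
  simpa using h (-n) x hx

/-- A fixed point of `φ_n` lies in the domain of every `φ_{jn}`, and `j = M` violates the bound
unless `n = 0`. Consequently distinct `φ_n` have disjoint graphs. -/
theorem Bounded.eq_zero_of_map_eq {N : PartialHomeoNest X} {M : ℕ} (h : N.Bounded M) {n : ℤ}
    {x : X} (hx : x ∈ (N.map n).source) (hfix : N.map n x = x) : n = 0 := by
  have key : ∀ j : ℕ, x ∈ (N.map (j * n)).source ∧ N.map (j * n) x = x := by
    intro j
    induction j with
    | zero => simpa using ⟨N.mem_zero x, N.map_zero_apply x⟩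
    | succ j ih =>
      have := N.nested n (j * n) x ih.1 (by rwa [ih.2])
      rw [ih.2, hfix] at this
      have e : ((j + 1 : ℕ) : ℤ) * n = n + j * n := by push_cast; ring
      rwa [e]
  have hM := h _ x (key M).1
  by_contra hn
  rw [abs_mul, Nat.abs_cast] at hM
  have : 1 ≤ |n| := Int.one_le_abs hn
  nlinarith

theorem Bounded.eq_of_map_eq {N : PartialHomeoNest X} {M : ℕ} (h : N.Bounded M) {a b : ℤ}
    {x : X} (ha : x ∈ (N.map a).source) (hb : x ∈ (N.map b).source)
    (hab : N.map a x = N.map b x) : a = b := by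
  obtain ⟨h1, h2⟩ := N.map_sub ha hb
  have := h.eq_zero_of_map_eq h1 (by rw [h2, hab])
  omega

/-! ### The successor map -/

/-- The set of times `n ≥ 1` at which `φ_n` is defined at `x`. -/
def futureTimes (N : PartialHomeoNest X) (x : X) : Set ℤ := {n : ℤ | 1 ≤ n ∧ x ∈ (N.map n).source}

theorem exists_isLeast_futureTimes (N : PartialHomeoNest X) {x : X} (hx : x ∈ N.xMaxᶜ) :
    ∃ k, IsLeast (N.futureTimes x) k := by
  rw [mem_compl_iff, mem_xMax] at hx
  push Not at hx
  obtain ⟨n, hn⟩ := hx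
  obtain ⟨k, hk, hle⟩ := Int.exists_least_of_bdd (P := fun n => n ∈ N.futureTimes x)
    ⟨1, fun z hz => hz.1⟩ ⟨n, hn⟩
  exact ⟨k, hk, hle⟩

open Classical in
/-- The value of the successor map at `x`, with the value `x` on `X_max`. -/
noncomputable def next (N : PartialHomeoNest X) (x : X) : X :=
  if h : ∃ k, IsLeast (N.futureTimes x) k then N.map h.choose x else x

theorem next_eq (N : PartialHomeoNest X) {x : X} {k : ℤ} (hk : IsLeast (N.futureTimes x) k) :
    N.next x = N.map k x := by
  have h : ∃ k, IsLeast (N.futureTimes x) k := ⟨k, hk⟩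
  rw [next, dif_pos h, h.choose_spec.unique hk]

/-- A return time `j < k` at `φ_k x` would make `k - j` a future time of `x` smaller than `k`. This
is why reversing the nest inverts the successor map. -/
theorem isLeast_futureTimes_rev (N : PartialHomeoNest X) {x : X} {k : ℤ}
    (hk : IsLeast (N.futureTimes x) k) : IsLeast (N.rev.futureTimes (N.map k x)) k := by
  refine ⟨⟨hk.1.1, N.mem_neg hk.1.2⟩, fun j hj => ?_⟩
  by_contra! hlt
  have h := (N.nested (-j) k x hk.1.2 hj.2).1
  have := hk.2 (show -j + k ∈ N.futureTimes x from ⟨by omega, h⟩)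
  have := hj.1
  omega

theorem next_mem (N : PartialHomeoNest X) {x : X} (hx : x ∈ N.xMaxᶜ) : N.next x ∈ N.xMinᶜ := by
  obtain ⟨k, hk⟩ := N.exists_isLeast_futureTimes hx
  rw [N.next_eq hk]
  exact fun h => N.mem_xMin.1 h k hk.1.1 (N.mem_neg hk.1.2)

theorem rev_next_next (N : PartialHomeoNest X) {x : X} (hx : x ∈ N.xMaxᶜ) :
    N.rev.next (N.next x) = x := by
  obtain ⟨k, hk⟩ := N.exists_isLeast_futureTimes hx
  rw [N.next_eq hk, N.rev.next_eq (N.isLeast_futureTimes_rev hk)]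
  exact N.map_neg_apply hk.1.2

theorem continuousOn_next (N : PartialHomeoNest X)
    (hdom : ∀ n : ℤ, 1 ≤ n → IsClosed (N.map n).source) : ContinuousOn N.next N.xMaxᶜ := by
  intro x hx
  obtain ⟨k, hk⟩ := N.exists_isLeast_futureTimes hx
  refine ContinuousAt.continuousWithinAt ?_
  -- On this neighbourhood the least future time is constantly `k`; it is open because the finitely
  -- many earlier domains are closed.
  have hopen : IsOpen ((N.map k).source ∩ ⋂ j ∈ Finset.Ico 1 k, (N.map j).sourceᶜ) :=
    (N.map k).open_source.inter (isOpen_biInter_finset fun j hj =>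
      (hdom j (Finset.mem_Ico.1 hj).1).isOpen_compl)
  have hmem : x ∈ (N.map k).source ∩ ⋂ j ∈ Finset.Ico 1 k, (N.map j).sourceᶜ := by
    refine ⟨hk.1.2, mem_iInter₂.2 fun j hj hxj => ?_⟩
    rw [Finset.mem_Ico] at hj
    have := hk.2 ⟨hj.1, hxj⟩
    omega
  refine ((N.map k).continuousAt hk.1.2).congr ?_
  filter_upwards [hopen.mem_nhds hmem] with y hy
  refine (N.next_eq ⟨⟨hk.1.1, hy.1⟩, fun j hj => ?_⟩).symm
  by_contra! hlt
  exact mem_iInter₂.1 hy.2 j (Finset.mem_Ico.2 ⟨hj.1, hlt⟩) hj.2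

/-- The successor map as a homeomorphism from `X ∖ X_max` to `X ∖ X_min`. -/
noncomputable def succHomeo (N : PartialHomeoNest X) (hmin : IsClosed N.xMin)
    (hmax : IsClosed N.xMax)
    (hdom : ∀ n : ℤ, 1 ≤ n → IsClosed (N.map n).source ∧ IsClosed (N.map (-n)).source) :
    OpenPartialHomeomorph X X where
  toFun := N.next
  invFun := N.rev.next
  source := N.xMaxᶜ
  target := N.xMinᶜ
  map_source' _ hx := N.next_mem hx
  map_target' _ hx := by simpa only [xMin_rev] using N.rev.next_mem hx
  left_inv' _ hx := N.rev_next_next hx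
  right_inv' _ hx := by simpa only [rev_rev] using N.rev.rev_next_next hx
  open_source := hmax.isOpen_compl
  open_target := hmin.isOpen_compl
  continuousOn_toFun := N.continuousOn_next fun n hn => (hdom n hn).1
  continuousOn_invFun := N.rev.continuousOn_next fun n hn => (hdom n hn).2

theorem isSuccessorMap_of_next (N : PartialHomeoNest X) {Φ : OpenPartialHomeomorph X X}
    (hs : Φ.source = N.xMaxᶜ) (hΦ : ∀ x, Φ x = N.next x) : N.IsSuccessorMap Φ :=
  ⟨hs, fun x _ _ hk => (hΦ x).trans (N.next_eq hk)⟩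

/-- Backward iterates of a set containing `X_max` under the successor map cover the space. -/
theorem IsSuccessorMap.iUnion_symm_iter {N : PartialHomeoNest X} {Φ : OpenPartialHomeomorph X X}
    (hΦ : N.IsSuccessorMap Φ) {M : ℕ} (hM : N.Bounded M) {V : Set X} (hV : N.xMax ⊆ V) :
    (⋃ n : ℕ, Φ.symm.iter n '' (V ∩ (Φ.symm.iter n).source)) = univ := by
  -- Induction on a bound `d` for the future times: a future time `n` of `Φ x = φ_k x` gives the
  -- future time `n + k` of `x`, and `k ≥ 1`.
  have key : ∀ (d : ℕ) (x : X), (∀ n ∈ N.futureTimes x, n ≤ d) →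
      ∃ n : ℕ, x ∈ Φ.symm.iter n '' (V ∩ (Φ.symm.iter n).source) := by
    intro d
    induction d with
    | zero =>
      intro x hx
      have hxm : x ∈ N.xMax := N.mem_xMax.2 fun n hn hxn => by
        have := hx n ⟨hn, hxn⟩
        omega
      exact ⟨0, x, ⟨hV hxm, trivial⟩, rfl⟩
    | succ d ih =>
      intro x hx
      by_cases hxm : x ∈ N.xMax
      · exact ⟨0, x, ⟨hV hxm, trivial⟩, rfl⟩
      obtain ⟨k, hk⟩ := N.exists_isLeast_futureTimes hxm
      have hval : Φ x = N.map k x := hΦ.2 x hxm k hk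
      have hsrc : x ∈ Φ.source := by rw [hΦ.1]; exact hxm
      obtain ⟨n, z, ⟨hzV, hzs⟩, hz⟩ := ih (Φ x) (by
        intro n hn
        rw [hval] at hn
        have h1 := hk.1.1
        have h2 := hn.1
        have := hx (n + k) ⟨by omega, (N.nested n k x hk.1.2 hn.2).1⟩
        push_cast at this
        omega)
      refine ⟨n + 1, z, ⟨hzV, ?_⟩, ?_⟩
      · change z ∈ ((Φ.symm.iter n).trans Φ.symm).source
        rw [OpenPartialHomeomorph.trans_source]
        refine ⟨hzs, ?_⟩
        rw [mem_preimage, hz]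
        exact Φ.map_source hsrc
      · change Φ.symm (Φ.symm.iter n z) = x
        rw [hz]
        exact Φ.left_inv hsrc
  refine eq_univ_of_forall fun x => mem_iUnion.2 (key M x fun n hn => ?_)
  exact ((le_abs_self n).trans_lt (hM n x hn.2)).le

theorem Bounded.isBratteliSystem_succHomeo {N : PartialHomeoNest X} {M : ℕ} (hM : N.Bounded M)
    (hmin : IsClosed N.xMin) (hmax : IsClosed N.xMax)
    (hdom : ∀ n : ℤ, 1 ≤ n → IsClosed (N.map n).source ∧ IsClosed (N.map (-n)).source) :
    N.IsSuccessorMap (N.succHomeo hmin hmax hdom) ∧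
      IsBratteliSystem N.xMax N.xMin (N.succHomeo hmin hmax hdom) := by
  have h1 : N.IsSuccessorMap (N.succHomeo hmin hmax hdom) :=
    N.isSuccessorMap_of_next rfl fun _ => rfl
  have h2 : N.rev.IsSuccessorMap (N.succHomeo hmin hmax hdom).symm :=
    N.rev.isSuccessorMap_of_next rfl fun _ => rfl
  refine ⟨h1, hmax, hmin, rfl, rfl, fun U _ hU => ?_, fun V _ hV => h1.iUnion_symm_iter hM hV⟩
  have h3 := h2.iUnion_symm_iter hM.rev (V := U) hU
  rwa [OpenPartialHomeomorph.symm_symm] at h3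

/-! ### The groupoid -/

theorem isOpen_graphOn (N : PartialHomeoNest X) (n : ℤ) {U : Set X} (hU : IsOpen U) :
    IsOpen (N.graphOn n U) :=
  TopologicalSpace.isOpen_generateFrom_of_mem ⟨n, U, hU, rfl⟩

theorem continuous_src (N : PartialHomeoNest X) : Continuous (RelArrow.src : N.Groupoid → X) := by
  refine continuous_def.2 fun U hU => ?_
  have : (RelArrow.src : N.Groupoid → X) ⁻¹' U = ⋃ n : ℤ, N.graphOn n U := by
    ext g
    obtain ⟨n, hn⟩ := g.rel
    simp only [mem_preimage, mem_iUnion]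
    exact ⟨fun h => ⟨n, h, hn⟩, fun ⟨_, h⟩ => h.1⟩
  rw [this]
  exact isOpen_iUnion fun n => N.isOpen_graphOn n hU

theorem continuous_tgt (N : PartialHomeoNest X) : Continuous (RelArrow.tgt : N.Groupoid → X) := by
  refine continuous_def.2 fun U hU => ?_
  have : (RelArrow.tgt : N.Groupoid → X) ⁻¹' U =
      ⋃ n : ℤ, N.graphOn n ((N.map n).source ∩ N.map n ⁻¹' U) := by
    ext g
    obtain ⟨n, hn⟩ := g.rel
    simp only [mem_preimage, mem_iUnion]
    refine ⟨fun h => ⟨n, ⟨hn.1, by rwa [mem_preimage, hn.2]⟩, hn⟩, fun ⟨m, h1, _, h2⟩ => ?_⟩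
    rw [← h2]
    exact h1.2
  rw [this]
  exact isOpen_iUnion fun n => N.isOpen_graphOn n ((N.map n).isOpen_inter_preimage hU)

/-- Needed so that a continuous bijection from a compact space onto the groupoid is a homeomorphism.
-/
theorem t2Space_groupoid [T2Space X] (N : PartialHomeoNest X) : T2Space N.Groupoid :=
  T2Space.of_injective_continuous (f := fun g : N.Groupoid => (g.src, g.tgt))
    (fun g h hgh => by
      rw [Prod.mk.injEq] at hgh
      exact RelArrow.ext hgh.1 hgh.2)
    (N.continuous_src.prodMk N.continuous_tgt)

/-- Every point is uniquely `φ_a y` with `y ∈ X_min`: existence. -/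
theorem Bounded.exists_base {N : PartialHomeoNest X} {M : ℕ} (hM : N.Bounded M) (x : X) :
    ∃ y ∈ N.xMin, ∃ a : Fin M, y ∈ (N.map (a : ℕ)).source ∧ N.map (a : ℕ) y = x := by
  -- For the least time `n ≤ 0` of `x`, the point `φ_n x` admits no further backward step, so it
  -- lies in `X_min`.
  obtain ⟨n, hn, hle⟩ := Int.exists_least_of_bdd (P := fun n => x ∈ (N.map n).source)
    ⟨-M, fun z hz => (abs_lt.1 (hM z x hz)).1.le⟩ ⟨0, N.mem_zero x⟩
  have hn0 := hle 0 (N.mem_zero x)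
  obtain ⟨a, rfl⟩ : ∃ a : ℕ, n = -a := ⟨n.natAbs, by omega⟩
  have hlt : a < M := by
    have := hM _ x hn
    rw [abs_neg, Nat.abs_cast] at this
    exact_mod_cast this
  refine ⟨N.map (-a) x, N.mem_xMin.2 fun m hm hxm => ?_, ⟨a, hlt⟩, ?_, ?_⟩
  · have := hle _ (N.nested _ _ x hn hxm).1
    omega
  · simpa using N.mem_neg hn
  · simpa using N.map_neg_apply hn

/-- Every point is uniquely `φ_a y` with `y ∈ X_min`: uniqueness. -/
theorem base_unique (N : PartialHomeoNest X) {y z : X} (hy : y ∈ N.xMin) (hz : z ∈ N.xMin)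
    {a b : ℤ} (ha : y ∈ (N.map a).source) (hb : z ∈ (N.map b).source)
    (hab : N.map a y = N.map b z) : a = b ∧ y = z := by
  -- `φ_{a-b}` is defined at `y` and `φ_{b-a}` at `z`; points of `X_min` have only nonnegative
  -- times, so `a = b`.
  have h1 := N.nested (-b) a y ha (by rw [hab]; exact N.mem_neg hb)
  have h2 := N.nested (-a) b z hb (by rw [← hab]; exact N.mem_neg ha)
  have h3 := N.nonneg_of_mem_xMin hy h1.1
  have h4 := N.nonneg_of_mem_xMin hz h2.1
  have h5 : a = b := by omega
  subst h5
  exact ⟨rfl, (N.map a).injOn ha hb hab⟩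

/-- The points of `X_min` at which, among the `φ_n` with `0 ≤ n < M`, exactly those with `n ∈ A`
are defined. -/
def baseSet (N : PartialHomeoNest X) {M : ℕ} (A : Finset (Fin M)) : Set X :=
  N.xMin ∩ {y | ∀ a : Fin M, y ∈ (N.map (a : ℕ)).source ↔ a ∈ A}

theorem isClopen_baseSet (N : PartialHomeoNest X) {M : ℕ} (hmin : IsClopen N.xMin)
    (hdom : ∀ n : ℤ, 1 ≤ n → IsClopen (N.map n).source) (A : Finset (Fin M)) :
    IsClopen (N.baseSet A) := by
  have hd : ∀ a : ℕ, IsClopen (N.map a).source := by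
    intro a
    rcases Nat.eq_zero_or_pos a with rfl | ha
    · rw [Nat.cast_zero, eq_univ_of_forall N.mem_zero]
      exact isClopen_univ
    · exact hdom a (by exact_mod_cast ha)
  refine hmin.inter ?_
  rw [ofPred_forall]
  refine isClopen_iInter_of_finite fun a => ?_
  by_cases ha : a ∈ A
  · simpa [ha] using hd a
  · simp only [ha, iff_false]
    exact (hd a).compl

theorem Bounded.isElementaryGroupoid_univ [CompactSpace X] [T2Space X] {N : PartialHomeoNest X}
    {M : ℕ} (hM : N.Bounded M) (hmin : IsClopen N.xMin)
    (hdom : ∀ n : ℤ, 1 ≤ n → IsClopen (N.map n).source) :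
    IsElementaryGroupoid N.rel univ := by
  classical
  let A : Fin (Fintype.card (Finset (Fin M))) ≃ Finset (Fin M) := (Fintype.equivFin _).symm
  -- `t k i` is the `i`-th time in `A k`, in an arbitrary enumeration.
  let t (k) (i : Fin (A k).card) : ℤ := (((A k).equivFin.symm i : Fin M) : ℕ)
  have hclopen (k : Fin (Fintype.card (Finset (Fin M)))) : IsClopen (N.baseSet (A k)) := N.isClopen_baseSet hmin hdom (A k)
  have (k : Fin (Fintype.card (Finset (Fin M)))) : CompactSpace (N.baseSet (A k)) :=
    isCompact_iff_compactSpace.1 (hclopen k).1.isCompact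
  have := N.t2Space_groupoid
  have hsrc (k) (y : N.baseSet (A k)) (i) : (y : X) ∈ (N.map (t k i)).source :=
    (y.2.2 _).2 ((A k).equivFin.symm i).2
  have hcont (k) (i) : Continuous fun y : N.baseSet (A k) => N.map (t k i) y :=
    (N.map (t k i)).continuousOn.comp_continuous continuous_subtype_val fun y => hsrc k y i
  -- each point of `X_min` lies in a `baseSet` whose times are all those at which it is in a domain
  have hidx (y : X) (hy : y ∈ N.xMin) : ∃ k, y ∈ N.baseSet (A k) ∧
      ∀ n : ℤ, y ∈ (N.map n).source → ∃ i, t k i = n := by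
    refine ⟨A.symm {a : Fin M | y ∈ (N.map (a : ℕ)).source}, ⟨hy, by simp⟩, fun n hn => ?_⟩
    have h0 := N.nonneg_of_mem_xMin hy hn
    have hlt := (abs_lt.1 (hM n y hn)).2
    obtain ⟨a, rfl⟩ := Int.eq_ofNat_of_zero_le h0
    have ha : (⟨a, by exact_mod_cast hlt⟩ : Fin M) ∈
        A (A.symm {a : Fin M | y ∈ (N.map (a : ℕ)).source}) := by simpa using hn
    exact ⟨(A _).equivFin ⟨_, ha⟩, by simp [t]⟩
  have hinj (k l) (y : N.baseSet (A k)) (z : N.baseSet (A l)) (i j)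
      (h : N.map (t k i) y = N.map (t l j) z) :
      (⟨k, (y, i)⟩ : Σ k, N.baseSet (A k) × Fin (A k).card) = ⟨l, (z, j)⟩ := by
    obtain ⟨h1, h2⟩ := N.base_unique y.2.1 z.2.1 (hsrc k y i) (hsrc l z j) h
    have hkl : k = l := by
      apply A.injective
      ext a
      rw [← y.2.2 a, ← z.2.2 a, h2]
    subst hkl
    have hij : i = j := by
      apply (A k).equivFin.symm.injective
      apply Subtype.ext
      exact Fin.ext (Int.ofNat_inj.1 h1)
    rw [hij, Subtype.ext h2]
  let f : (Σ k, N.baseSet (A k) × Fin (A k).card) → X := fun p => N.map (t p.1 p.2.2) p.2.1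
  have hf : Continuous f := continuous_sigma fun k =>
    continuous_prod_of_discrete_right.2 fun i => hcont k i
  have hfb : Function.Bijective f := by
    refine ⟨fun ⟨k, y, i⟩ ⟨l, z, j⟩ h => hinj k l y z i j h, fun x => ?_⟩
    obtain ⟨y, hy, a, ha, rfl⟩ := hM.exists_base x
    obtain ⟨k, hk, ht⟩ := hidx y hy
    obtain ⟨i, hi⟩ := ht _ ha
    exact ⟨⟨k, (⟨y, hk⟩, i)⟩, by simp only [f, hi]⟩
  have hrel (k) (y : N.baseSet (A k)) (i j) :=
    N.map_sub (hsrc k y i) (hsrc k y j)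
  let F : (Σ k, N.baseSet (A k) × (Fin (A k).card × Fin (A k).card)) → N.Groupoid := fun p =>
    ⟨N.map (t p.1 p.2.2.1) p.2.1, N.map (t p.1 p.2.2.2) p.2.1, _, hrel p.1 p.2.1 p.2.2.1 p.2.2.2⟩
  have hF : Continuous F := by
    refine continuous_sigma fun k => continuous_prod_of_discrete_right.2 fun ⟨i, j⟩ => ?_
    refine continuous_generateFrom_iff.2 ?_
    rintro _ ⟨n, U, hU, rfl⟩
    -- By disjointness of the graphs, the arrow from `φ_{t k i} y` to `φ_{t k j} y` lies only in the
    -- graph of index `t k j - t k i`; for any other `n` the preimage is empty.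
    by_cases hn : n = t k j - t k i
    · convert hU.preimage (hcont k i) using 1
      ext y
      subst hn
      exact ⟨fun h => h.1, fun h => ⟨h, hrel k y i j⟩⟩
    · convert isOpen_empty using 1
      refine eq_empty_of_forall_notMem fun y hy => hn ?_
      exact hM.eq_of_map_eq hy.2.1 (hrel k y i j).1 (hy.2.2.trans (hrel k y i j).2.symm)
  have hFb : Function.Bijective F := by
    refine ⟨fun ⟨k, y, i, j⟩ ⟨l, z, i', j'⟩ h => ?_, fun g => ?_⟩
    · have h1 := hinj k l y z i i' (congrArg RelArrow.src h)
      have h2 := hinj k l y z j j' (congrArg RelArrow.tgt h)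
      obtain rfl : k = l := congrArg Sigma.fst h1
      simp only [Sigma.mk.injEq, heq_eq_eq, Prod.mk.injEq, true_and] at h1 h2
      rw [h1.1, h1.2, h2.2]
    · obtain ⟨y, hy, a, ha, hx⟩ := hM.exists_base g.src
      obtain ⟨k, hk, ht⟩ := hidx y hy
      obtain ⟨i, hi⟩ := ht _ ha
      obtain ⟨n, hn, hxn⟩ := g.rel
      rw [← hx] at hn hxn
      -- The target of `g` is `φ_{n+a} y`, so `n + a` is again a time of the same base point.
      have hna := N.nested n _ y ha hn
      obtain ⟨j, hj⟩ := ht _ hna.1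
      refine ⟨⟨k, (⟨y, hk⟩, (i, j))⟩, RelArrow.ext ?_ ?_⟩
      · simp only [F, hi, hx]
      · simp only [F, hj, hna.2, hxn]
  exact ⟨_, fun k => (A k).card, fun k => N.baseSet (A k), hclopen,
    hf.homeoOfEquivCompactToT2 (f := Equiv.ofBijective f hfb),
    (hF.homeoOfEquivCompactToT2 (f := Equiv.ofBijective F hFb)).trans
      (Homeomorph.Set.univ N.Groupoid).symm,
    fun k y i j => ⟨rfl, rfl⟩⟩

end PartialHomeoNest

theorem lemma5p1 {X : Type*} [TopologicalSpace X] [CompactSpace X] [T2Space X]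
    [TotallyDisconnectedSpace X] (N : PartialHomeoNest X)
    (hmin : IsClopen N.xMin) (hmax : IsClopen N.xMax)
    (hdom : ∀ n : ℤ, 1 ≤ n → IsClopen (N.map n).source ∧ IsClopen (N.map (-n)).source)
    (hM : ∃ M : ℤ, 1 ≤ M ∧ ∀ n : ℤ, M ≤ |n| → (N.map n).source = ∅) :
    IsAFGroupoid N.rel ∧
      ∃ Φ : OpenPartialHomeomorph X X,
        N.IsSuccessorMap Φ ∧ IsBratteliSystem N.xMax N.xMin Φ := by
  obtain ⟨M, hM1, hM⟩ := hM
  have hB : N.Bounded M.toNat := by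
    intro n x hx
    by_contra! h
    rw [hM n (by omega)] at hx
    exact hx
  refine ⟨⟨fun _ => univ, monotone_const, iUnion_const _, fun _ => ⟨isOpen_univ, ?_⟩⟩, _,
    hB.isBratteliSystem_succHomeo hmin.1 hmax.1 fun n hn => ⟨(hdom n hn).1.1, (hdom n hn).2.1⟩⟩
  exact hB.isElementaryGroupoid_univ hmin fun n hn => (hdom n hn).1
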